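/- For a permutation $\pi=\pi_1\cdots\pi_n$ of $\{1,\dots,n\}$ let $\mathrm{altdes}(\pi)$ be the number of indices $i\in\{1,\dots,n-1\}$ such that $i$ is odd and $\pi_i>\pi_{i+1}$, or $i$ is even and $\pi_i<\pi_{i+1}$. Let $\widehat A_n(t)=\sum_{\pi\in\mathfrak S_n}t^{\mathrm{altdes}(\pi)}$. Let $E_n$ be the Euler number, i.e. the number of down-up permutations $\pi\in\mathfrak S_n$, those with $\pi_1>\pi_2<\pi_3>\pi_4<\cdots$. For odd $m\ge 1$ define $a(m,k)$, $0\le k\le (m-1)/2$, by the expansion $$\widehat A_m(t)=\sum_{k=0}^{(m-1)/2}a(m,k)\,(-2t)^k(1+t)^{m-1-2k}.$$ A permutation $\pi\in\mathfrak S_n$ is called Simsun if, for every $0\le k\le n$, the word obtained from $\pi_1\cdots\pi_n$ by removing all letters larger than $k$ contains no three consecutive letters $x>y>z$. Then for every $n\ge 0$ the expansion above exists for $m=2n+1$, and $$\widehat A_{2n+1}(-1)=2^n\,a(2n+1,n)=E_{2n+1}.$$ Moreover, the number of down-up Simsun permutations of length $2n$ is $E_{2n+1}/2^n$, which is the $n$-th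 reduced tangent number (counted from $n=0$) $$\frac{2^{n+1}\bigl(2^{2(n+1)}-1\bigr)\,|B_{2(n+1)}|}{n+1},$$ where $B_j$ denotes the $j$-th Bernoulli number. -/

import Mathlib

open Polynomial

namespace AltDescent

/-- The alternating descent set of `π`. The entry `i : Fin n` stands for the position `i + 1` of the
word `π_1 ⋯ π_n`, so an even `i` is an odd position (where a descent is required) and an odd `i` is
an even position (where an ascent is required). -/
def altDescentSet {n : ℕ} (π : Equiv.Perm (Fin n)) : Finset (Fin n) :=
  Finset.univ.filter fun i =>
    ∃ h : (i : ℕ) + 1 < n,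
      (Even (i : ℕ) ∧ π ⟨(i : ℕ) + 1, h⟩ < π i) ∨ (Odd (i : ℕ) ∧ π i < π ⟨(i : ℕ) + 1, h⟩)

/-- The number of alternating descents of `π`. -/
def altdes {n : ℕ} (π : Equiv.Perm (Fin n)) : ℕ := (altDescentSet π).card

/-- The alternating Eulerian polynomial. -/
noncomputable def altEulerianPoly (n : ℕ) : ℤ[X] :=
  ∑ π : Equiv.Perm (Fin n), X ^ altdes π

/-- `a 0, …, a ⌊(n-1)/2⌋` are the coefficients of the expansion of the `n`-th alternating Eulerian
polynomial in the polynomials `(-2t)^k (1+t)^(n-1-2k)` (for `n ≥ 1`). -/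
def IsAltGammaVector (n : ℕ) (a : ℕ → ℝ) : Prop :=
  (altEulerianPoly n).map (Int.castRingHom ℝ) =
    ∑ k ∈ Finset.range ((n - 1) / 2 + 1), C (a k) * (-2 * X) ^ k * (1 + X) ^ (n - 1 - 2 * k)

/-- `π_1 > π_2 < π_3 > π_4 < ⋯`. -/
def IsDownUp {n : ℕ} (π : Equiv.Perm (Fin n)) : Prop :=
  ∀ (i : Fin n) (h : (i : ℕ) + 1 < n),
    (Even (i : ℕ) → π ⟨(i : ℕ) + 1, h⟩ < π i) ∧ (Odd (i : ℕ) → π i < π ⟨(i : ℕ) + 1, h⟩)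

/-- The Euler number `E_n`, the number of down-up permutations of length `n`. -/
noncomputable def eulerNumber (n : ℕ) : ℕ := Set.ncard {π : Equiv.Perm (Fin n) | IsDownUp π}

/-- A word has a double descent if it has three consecutive letters `a > b > c`. -/
def HasDoubleDescent {α : Type*} [LT α] (w : List α) : Prop :=
  ∃ a b c : α, [a, b, c] <:+: w ∧ b < a ∧ c < b

/-- `π` is a Simsun permutation: the word of `π` has no double descents, and neither have the words
obtained by removing the largest letters. (Here the letters are `0, …, n - 1`, and for `k = n` no
letter is removed.) -/
def IsSimsun {n : ℕ} (π : Equiv.Perm (Fin n)) : Prop :=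
  ∀ k ≤ n, ¬ HasDoubleDescent ((List.ofFn π).filter fun x : Fin n => (x : ℕ) < k)

/-- The reduced tangent numbers `1, 1, 4, 34, 496, …`, indexed from `0`: the classical sequence
`2^m (2^(2m) - 1) |B_(2m)| / m` for `m = n + 1`, with `B` the Bernoulli numbers. -/
def reducedTangentNumber (n : ℕ) : ℚ :=
  2 ^ (n + 1) * (2 ^ (2 * (n + 1)) - 1) * |_root_.bernoulli (2 * (n + 1))| / ((n + 1 : ℕ) : ℚ)

end AltDescent

/-! ### Weights of words under insertion of a largest letter -/

namespace AltDescent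

/-! Permutations are grown by inserting the largest letter. A word is read from left to right, as if
after a descent to `0`, and gets a product of local weights, a valley weighing `1`. If the weights
lie in a ring with a compatible derivation `D`, the Leibniz rule spreads `D` over the places of
insertion, so the total weight of the words of length `m` is `D^[m]` of the weight of the empty word
(`sum_words_eval`). When double descents weigh `0`, the same holds for the sum over Simsun words
(`sum_words_eval_simsun`).

The ring used is that of power series, evaluated at `0`. A solution of `y' = 1 - c * y ^ 2`, `y 0 =
0`, yields suitable weights in three cases: `c = -1` (tan) counts down-up permutations of odd
length, `c = -1/2` counts down-up Simsun permutations of even length, and `c = 1` (tanh) produces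
the signs `(-1) ^ altdes`. With `c = s ^ 2 / 4` the solution is `tangentSeries s`, whose derivative
of order `2 * n + 1` at `0` is `(s ^ 2) ^ n` times a Bernoulli factor free of `s`. Comparing `s ^ 2
= -4, -2, 4` gives all the numerical identities.

The expansion exists because complementing permutations makes the polynomial palindromic; at `t =
-1` only its term `k = n` survives. -/

/-- Multiplicative weights of words, read from left to right. The Boolean records whether the last
step was an ascent, the number `b` is the last letter read. -/
structure WordWeight (R : Type*) where
  endUp : R
  endDown : R
  peak : R
  doubleAscent : R
  doubleDescent : R

namespace WordWeight

variable {A R : Type*} [CommRing A] [CommRing R] [Algebra A R]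

/-- The weight of the word `w` which follows the letter `b`. -/
def eval (W : WordWeight R) : Bool → ℕ → List ℕ → R
  | s, _, [] => if s then W.endUp else W.endDown
  | s, b, c :: w =>
    if c < b then (if s then W.peak else W.doubleDescent) * W.eval false c w
    else (if s then W.doubleAscent else 1) * W.eval true c w

/-- The image of a weight under a ring homomorphism. -/
def map {S : Type*} [CommRing S] (f : R →+* S) (W : WordWeight R) : WordWeight S :=
  ⟨f W.endUp, f W.endDown, f W.peak, f W.doubleAscent, f W.doubleDescent⟩

theorem eval_map {S : Type*} [CommRing S] (f : R →+* S) (W : WordWeight R) (s : Bool) (b : ℕ)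
    (w : List ℕ) : (W.map f).eval s b w = f (W.eval s b w) := by
  induction w generalizing s b with
  | nil => cases s <;> simp [eval, map]
  | cons c w ih => cases s <;> simp only [eval] <;> split_ifs <;> simp_all [map]

/-- The word `w` continues a word without double descents without creating one. -/
def NoDoubleDescentFrom : Bool → ℕ → List ℕ → Prop
  | _, _, [] => True
  | s, b, c :: w =>
    if c < b then s = true ∧ NoDoubleDescentFrom false c w else NoDoubleDescentFrom true c w

/-- The weight is compatible with the derivation `D`: inserting a new largest letter at all places
of a word acts as `D`, apart from insertions between the two letters of a double descent. -/
structure IsCompatible (W : WordWeight R) (D : Derivation A R R) : Prop where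
  endDown : D W.endDown = W.endUp
  endUp : D W.endUp = W.peak * W.endDown + W.doubleAscent * W.endUp
  peak : D W.peak = W.peak * (W.doubleAscent + W.doubleDescent)
  doubleAscent : D W.doubleAscent = W.peak

/-- The extra summand is the insertion just before `b`, when `b` was reached by an ascent: the
ascent now ends in `t`, and a peak at `t` leads down to `b`. Carrying it along makes the induction
on `w` close. -/
theorem sum_eval_permutations'Aux {W : WordWeight R} {D : Derivation A R R} (h : W.IsCompatible D)
    (t : ℕ) (w : List ℕ) (hw : ∀ c ∈ w, c < t) (s : Bool) (b : ℕ) (hb : b ≤ t)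
    (hd : D W.doubleDescent = W.peak ∨ NoDoubleDescentFrom s b w) :
    (if s then W.peak * W.eval false b w else 0) +
      ((List.permutations'Aux t w).map (W.eval s b)).sum = D (W.eval s b w) := by
  induction w generalizing s b with
  | nil =>
    cases s
    · simp [List.permutations'Aux, eval, h.endDown, hb.not_gt]
    · simp [List.permutations'Aux, eval, h.endUp, hb.not_gt]
  | cons c w ih =>
    have hc : c < t := hw c (by simp)
    have ih' := fun s hd => ih (fun c hc => hw c (by simp [hc])) s c hc.le hd
    simp only [List.permutations'Aux, List.map_cons, List.map_map, List.sum_cons]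
    have e1 : W.eval s b (t :: c :: w)
        = (if s then W.doubleAscent else 1) * (W.peak * W.eval false c w) := by
      simp [eval, hb.not_gt, hc]
    rw [e1]
    by_cases hcb : c < b
    · have e2 : (W.eval s b ∘ List.cons c)
          = fun u => (if s then W.peak else W.doubleDescent) * W.eval false c u := by
        funext u; simp [eval, hcb]
      have i := ih' false (hd.imp_right fun h => by
        simp only [NoDoubleDescentFrom, hcb, if_true] at h
        exact h.2)
      simp only [Bool.false_eq_true, if_false, zero_add] at i
      rw [e2, List.sum_map_mul_left, i]
      cases s
      -- Here `b > c` continues a descent, which excludes the second alternative of `hd`.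
      · have hd' : D W.doubleDescent = W.peak := by
          simpa [NoDoubleDescentFrom, hcb] using hd
        simp [eval, hcb, hd']; ring
      · simp [eval, hcb, h.peak]; ring
    · have e2 : (W.eval s b ∘ List.cons c)
          = fun u => (if s then W.doubleAscent else 1) * W.eval true c u := by
        funext u; simp [eval, hcb]
      have i := ih' true (hd.imp_right fun h => by simpa [NoDoubleDescentFrom, hcb] using h)
      simp only [if_true] at i
      rw [e2, List.sum_map_mul_left, add_comm (W.peak * _), ← eq_sub_iff_add_eq] at *
      rw [i]
      cases s
      · simp [eval, hcb]
      · simp [eval, hcb, h.doubleAscent]; ring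

theorem eval_eq_zero_of_not_noDoubleDescentFrom {W : WordWeight R} (hW : W.doubleDescent = 0)
    {s : Bool} {b : ℕ} {w : List ℕ} (h : ¬ NoDoubleDescentFrom s b w) : W.eval s b w = 0 := by
  induction w generalizing s b with
  | nil => simp [NoDoubleDescentFrom] at h
  | cons c w ih =>
    by_cases hcb : c < b <;> cases s <;>
      simp only [NoDoubleDescentFrom, hcb, if_true, if_false] at h <;>
      simp_all [eval]

end WordWeight

/-! ### Double descents and Simsun words -/

theorem hasDoubleDescent_cons_iff {α : Type*} [LT α] (x : α) (w : List α) :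
    HasDoubleDescent (x :: w) ↔
      (∃ b c w', w = b :: c :: w' ∧ b < x ∧ c < b) ∨ HasDoubleDescent w := by
  constructor
  · rintro ⟨a, b, c, h, h1, h2⟩
    rw [List.infix_cons_iff] at h
    rcases h with ⟨v, h⟩ | h
    · simp only [List.cons_append, List.nil_append, List.cons.injEq] at h
      obtain ⟨rfl, rfl⟩ := h
      exact Or.inl ⟨b, c, v, rfl, h1, h2⟩
    · exact Or.inr ⟨a, b, c, h, h1, h2⟩
  · rintro (⟨b, c, v, rfl, h1, h2⟩ | ⟨a, b, c, h, h1, h2⟩)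
    · exact ⟨x, b, c, ⟨[], v, by simp⟩, h1, h2⟩
    · exact ⟨a, b, c, List.infix_cons_iff.2 (Or.inr h), h1, h2⟩

theorem not_hasDoubleDescent_nil {α : Type*} [LT α] : ¬ HasDoubleDescent ([] : List α) := by
  rintro ⟨a, b, c, h, -⟩
  simpa using h.length_le

theorem hasDoubleDescent_map_val {n : ℕ} (w : List (Fin n)) :
    HasDoubleDescent (w.map Fin.val) ↔ HasDoubleDescent w := by
  induction w with
  | nil => simp [not_hasDoubleDescent_nil]
  | cons x w ih =>
    rw [List.map_cons, hasDoubleDescent_cons_iff, hasDoubleDescent_cons_iff, ih]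
    refine or_congr_left ?_
    rcases w with _ | ⟨y, _ | ⟨z, w⟩⟩ <;> simp

namespace WordWeight

theorem noDoubleDescentFrom_iff (b : ℕ) (w : List ℕ) :
    (NoDoubleDescentFrom true b w ↔ ¬ HasDoubleDescent (b :: w)) ∧
    (NoDoubleDescentFrom false b w ↔ ¬ HasDoubleDescent (b :: w) ∧ ∀ c ∈ w.head?, b ≤ c) := by
  induction w generalizing b with
  | nil => simp [NoDoubleDescentFrom, hasDoubleDescent_cons_iff, not_hasDoubleDescent_nil]
  | cons c w ih =>
    obtain ⟨i1, i2⟩ := ih c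
    rw [hasDoubleDescent_cons_iff b]
    simp only [NoDoubleDescentFrom, i1, i2]
    by_cases hcb : c < b
    · simp only [hcb, if_true]
      rcases w with _ | ⟨d, w⟩
      · simp [hasDoubleDescent_cons_iff, not_hasDoubleDescent_nil, hcb]
      · simp [hcb]; tauto
    · rcases w with _ | ⟨d, w⟩ <;> simp [hcb] <;> omega

/-- No letter is below `0`, so the first step always counts as an ascent and the virtual start adds
no condition. -/
theorem noDoubleDescentFrom_false_zero_iff (w : List ℕ) :
    NoDoubleDescentFrom false 0 w ↔ ¬ HasDoubleDescent w := by
  rcases w with _ | ⟨c, w⟩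
  · simp [NoDoubleDescentFrom, not_hasDoubleDescent_nil]
  · simpa [NoDoubleDescentFrom] using (noDoubleDescentFrom_iff c w).1

variable {A R : Type*} [CommRing A] [CommRing R] [Algebra A R]

/-- The words which are permutations of `0, …, m - 1`. -/
def words (m : ℕ) : List (List ℕ) := (List.range m).reverse.permutations'

theorem words_succ (m : ℕ) : words (m + 1) = (words m).flatMap (List.permutations'Aux m) := by
  simp [words, List.range_succ, List.permutations']

theorem mem_words {m : ℕ} {w : List ℕ} : w ∈ words m ↔ w.Perm (List.range m) := by
  rw [words, List.mem_permutations']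
  exact ⟨fun h => h.trans (List.reverse_perm _), fun h => h.trans (List.reverse_perm _).symm⟩

theorem lt_of_mem_words {m : ℕ} {w : List ℕ} (hw : w ∈ words m) : ∀ c ∈ w, c < m := by
  intro c hc
  simpa using (mem_words.1 hw).subset hc

theorem sum_words_eval {W : WordWeight R} {D : Derivation A R R} (h : W.IsCompatible D)
    (hd : D W.doubleDescent = W.peak) (m : ℕ) :
    ((words m).map (W.eval false 0)).sum = D^[m] W.endDown := by
  induction m with
  | zero => simp [words, eval]
  | succ m ih =>
    rw [Function.iterate_succ_apply', ← ih, map_list_sum, words_succ, List.map_flatMap,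
      List.flatMap_def, List.sum_flatten, List.map_map, List.map_map]
    congr 1
    refine List.map_congr_left fun w hw => ?_
    simpa using sum_eval_permutations'Aux h m w (lt_of_mem_words hw) false 0 m.zero_le (Or.inl hd)

/-- The Simsun property of words. -/
def IsSimsunWord (w : List ℕ) : Prop := ∀ k, ¬ HasDoubleDescent (w.filter (· < k))

theorem filter_permutations'Aux {α : Type*} {p : α → Bool} {t : α} (ht : p t = false)
    {w u : List α}
    (hu : u ∈ List.permutations'Aux t w) : u.filter p = w.filter p := by
  induction w generalizing u with
  | nil => simp_all [List.permutations'Aux]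
  | cons c w ih =>
    simp only [List.permutations'Aux, List.mem_cons, List.mem_map] at hu
    rcases hu with rfl | ⟨v, hv, rfl⟩
    · simp [ht]
    · simp [List.filter_cons, ih hv]

/-- Truncations at `k ≤ m` do not see the inserted letter `m`, so the only new condition concerns
the full word. -/
theorem isSimsunWord_insert_iff {m : ℕ} {w u : List ℕ} (hw : w ∈ words m)
    (hu : u ∈ List.permutations'Aux m w) :
    IsSimsunWord u ↔ IsSimsunWord w ∧ ¬ HasDoubleDescent u := by
  have hu' : u ∈ words (m + 1) := by
    rw [words_succ, List.mem_flatMap]; exact ⟨w, hw, hu⟩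
  have hlow : ∀ k ≤ m, u.filter (· < k) = w.filter (· < k) := fun k hk =>
    filter_permutations'Aux (by simpa using hk) hu
  have hhigh : ∀ k, m < k → u.filter (· < k) = u := fun k hk =>
    List.filter_eq_self.2 fun c hc => by
      have := lt_of_mem_words hu' c hc
      simp; omega
  have hself : ∀ k, m ≤ k → w.filter (· < k) = w.filter (· < m) := fun k hk => by
    rw [List.filter_eq_self.2, List.filter_eq_self.2] <;> intro c hc <;>
      have := lt_of_mem_words hw c hc <;> simp <;> omega
  constructor
  · refine fun h => ⟨fun k => ?_, ?_⟩
    · rcases le_total k m with hk | hk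
      · rw [← hlow k hk]; exact h k
      · rw [hself k hk, ← hlow m le_rfl]; exact h m
    · have := h (m + 1)
      rwa [hhigh _ m.lt_succ_self] at this
  · rintro ⟨h1, h2⟩ k
    rcases le_or_gt k m with hk | hk
    · rw [hlow k hk]; exact h1 k
    · rwa [hhigh k hk]

theorem IsSimsunWord.not_hasDoubleDescent {w : List ℕ} {m : ℕ} (hw : w ∈ words m)
    (h : IsSimsunWord w) : ¬ HasDoubleDescent w := by
  have := h m
  rwa [List.filter_eq_self.2] at this
  intro c hc
  simpa using lt_of_mem_words hw c hc

-- Insertions that create a double descent have weight `0`, so discarding them costs nothing; the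
-- remaining ones are exactly the Simsun extensions of a Simsun word.
open Classical in
theorem sum_words_eval_simsun {W : WordWeight R} {D : Derivation A R R} (h : W.IsCompatible D)
    (hd : W.doubleDescent = 0) (m : ℕ) :
    ((words m).map fun w => if IsSimsunWord w then W.eval false 0 w else 0).sum
      = D^[m] W.endDown := by
  induction m with
  | zero =>
    have : IsSimsunWord [] := fun k => by simpa using not_hasDoubleDescent_nil
    simp [words, eval, this]
  | succ m ih =>
    rw [Function.iterate_succ_apply', ← ih, map_list_sum, words_succ, List.map_flatMap,
      List.flatMap_def, List.sum_flatten, List.map_map, List.map_map]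
    congr 1
    refine List.map_congr_left fun w hw => ?_
    by_cases hs : IsSimsunWord w
    · have := sum_eval_permutations'Aux h m w (lt_of_mem_words hw) false 0 m.zero_le
        (Or.inr ((noDoubleDescentFrom_false_zero_iff w).2 (hs.not_hasDoubleDescent hw)))
      simp only [Bool.false_eq_true, if_false, zero_add] at this
      simp only [Function.comp_apply, if_pos hs]
      rw [← this]
      congr 1
      refine List.map_congr_left fun u hu => ?_
      split_ifs with hu'
      · rfl
      · rw [isSimsunWord_insert_iff hw hu, ← noDoubleDescentFrom_false_zero_iff] at hu'
        exact (eval_eq_zero_of_not_noDoubleDescentFrom hd fun h => hu' ⟨hs, h⟩).symm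
    · simp only [Function.comp_apply, if_neg hs, map_zero]
      refine List.sum_eq_zero fun x hx => ?_
      obtain ⟨u, hu, rfl⟩ := List.mem_map.1 hx
      rw [if_neg fun h => hs ((isSimsunWord_insert_iff hw hu).1 h).1]

end WordWeight

/-! ### Permutations as words -/

/-- The word of a permutation. -/
def wordOf {m : ℕ} (π : Equiv.Perm (Fin m)) : List ℕ := List.ofFn fun i => (π i : ℕ)

theorem wordOf_perm_range {m : ℕ} (π : Equiv.Perm (Fin m)) : (wordOf π).Perm (List.range m) := by
  have h1 : (wordOf π).Nodup := List.nodup_ofFn.2 (Fin.val_injective.comp π.injective)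
  rw [List.perm_ext_iff_of_nodup h1 List.nodup_range]
  intro a
  simp only [wordOf, List.mem_ofFn, List.mem_range]
  constructor
  · rintro ⟨i, rfl⟩
    exact (π i).2
  · intro ha
    exact ⟨π.symm ⟨a, ha⟩, by simp⟩

theorem exists_wordOf_eq {m : ℕ} {w : List ℕ} (hw : w.Perm (List.range m)) :
    ∃ π : Equiv.Perm (Fin m), wordOf π = w := by
  have hl : w.length = m := by simpa using hw.length_eq
  have hn : w.Nodup := hw.nodup_iff.2 List.nodup_range
  subst hl
  have hlt : ∀ i : Fin w.length, w[i] < w.length := fun i => by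
    simpa using hw.subset (List.getElem_mem i.2)
  let f : Fin w.length → Fin w.length := fun i => ⟨w[i], hlt i⟩
  have hf : Function.Injective f := fun i j hij => by
    have : w[i] = w[j] := congrArg Fin.val hij
    exact Fin.ext ((hn.getElem_inj_iff).1 this)
  refine ⟨Equiv.ofBijective f (Finite.injective_iff_bijective.1 hf), ?_⟩
  simp [wordOf, f]

theorem wordOf_injective {m : ℕ} : Function.Injective (wordOf (m := m)) := fun π σ h => by
  ext i
  exact congrFun (List.ofFn_injective h) i

theorem sum_perm_eq_sum_words {R : Type*} [AddCommMonoid R] {m : ℕ} (f : List ℕ → R) :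
    ∑ π : Equiv.Perm (Fin m), f (wordOf π) = ((WordWeight.words m).map f).sum := by
  have hn : (WordWeight.words m).Nodup := by
    rw [WordWeight.words, ← (List.permutations_perm_permutations' _).nodup_iff]
    exact List.nodup_permutations _ (List.nodup_reverse.2 List.nodup_range)
  rw [← List.sum_toFinset f hn]
  refine Finset.sum_bij (fun π _ => wordOf π) ?_ ?_ ?_ ?_
  · intro π _
    simpa [WordWeight.mem_words] using wordOf_perm_range π
  · intro π _ σ _ h
    exact wordOf_injective h
  · intro w hw
    obtain ⟨π, rfl⟩ := exists_wordOf_eq (WordWeight.mem_words.1 (List.mem_toFinset.1 hw))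
    exact ⟨π, Finset.mem_univ _, rfl⟩
  · intro π _
    rfl

/-! ### The tangent series and Bernoulli numbers -/

open PowerSeries (exp rescale derivative)

/-- The power series of `tanh (t / 2)`. -/
noncomputable def tanhHalfSeries : PowerSeries ℂ := (exp ℂ - 1) * (exp ℂ + 1)⁻¹

theorem tanhHalfSeries_mul : tanhHalfSeries * (exp ℂ + 1) = exp ℂ - 1 := by
  rw [tanhHalfSeries, mul_assoc, PowerSeries.inv_mul_cancel, mul_one]
  simp

theorem exp_add_one_ne_zero : exp ℂ + 1 ≠ 0 := fun h => by
  have := congrArg PowerSeries.constantCoeff h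
  norm_num at this

theorem exp_sub_one_ne_zero : exp ℂ - 1 ≠ 0 := fun h => by
  have := congrArg (PowerSeries.coeff 1) h
  simp [PowerSeries.coeff_exp, PowerSeries.coeff_one] at this

theorem constantCoeff_tanhHalfSeries : PowerSeries.constantCoeff tanhHalfSeries = 0 := by
  simp [tanhHalfSeries]

theorem two_mul_derivative_tanhHalfSeries :
    2 * derivative ℂ tanhHalfSeries = 1 - tanhHalfSeries ^ 2 := by
  have h := congrArg (derivative ℂ) tanhHalfSeries_mul
  simp only [Derivation.leibniz, map_add, map_sub, PowerSeries.derivative_exp,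
    PowerSeries.derivative_one, smul_eq_mul] at h
  apply mul_right_cancel₀ (pow_ne_zero 2 exp_add_one_ne_zero)
  have h1 := tanhHalfSeries_mul
  linear_combination 2 * (exp ℂ + 1) * h +
    (tanhHalfSeries * (exp ℂ + 1) + (exp ℂ - 1) - 2 * exp ℂ) * h1

theorem derivative_rescale (s : ℂ) (f : PowerSeries ℂ) :
    derivative ℂ (rescale s f) = PowerSeries.C s * rescale s (derivative ℂ f) := by
  ext n
  simp [PowerSeries.coeff_derivative, PowerSeries.coeff_rescale, PowerSeries.coeff_C_mul]
  ring

/-- Partial fractions: `tanh (t/2) = 1 - 2/(e^t + 1)` and `1/(e^t + 1) = 1/(e^t - 1) - 2/(e^(2t) -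
1)`. -/
theorem X_mul_tanhHalfSeries :
    PowerSeries.X * tanhHalfSeries =
      PowerSeries.X - 2 * bernoulliPowerSeries ℂ + 2 * rescale 2 (bernoulliPowerSeries ℂ) := by
  have hB := bernoulliPowerSeries_mul_exp_sub_one ℂ
  have hB2 : rescale (2 : ℂ) (bernoulliPowerSeries ℂ) * (exp ℂ ^ 2 - 1) = 2 * PowerSeries.X := by
    have := congrArg (rescale (2 : ℂ)) hB
    have h2 := PowerSeries.exp_pow_eq_rescale_exp (A := ℂ) 2
    rw [map_mul, map_sub, map_one, PowerSeries.rescale_X] at this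
    rw [h2]
    push_cast
    rw [this]
    congr 1
  apply mul_right_cancel₀ (mul_ne_zero exp_add_one_ne_zero exp_sub_one_ne_zero)
  linear_combination PowerSeries.X * (exp ℂ - 1) * tanhHalfSeries_mul
    + 2 * (exp ℂ + 1) * hB - 2 * hB2

theorem coeff_tanhHalfSeries (n : ℕ) :
    PowerSeries.coeff (2 * n + 1) tanhHalfSeries
      = 2 * (2 ^ (2 * n + 2) - 1) * (bernoulli (2 * n + 2) : ℂ) / (2 * n + 2).factorial := by
  have h := congrArg (PowerSeries.coeff (2 * n + 2)) X_mul_tanhHalfSeries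
  rw [PowerSeries.coeff_succ_X_mul] at h
  have e2 : (2 : PowerSeries ℂ) = PowerSeries.C 2 := (map_ofNat _ 2).symm
  rw [h, map_add, map_sub, e2, PowerSeries.coeff_C_mul, PowerSeries.coeff_C_mul,
    PowerSeries.coeff_rescale, PowerSeries.coeff_X, if_neg (by omega)]
  simp [bernoulliPowerSeries]
  ring

/-- The solution of `y' = 1 - (s / 2) ^ 2 * y ^ 2`, `y 0 = 0`. -/
noncomputable def tangentSeries (s : ℂ) : PowerSeries ℂ :=
  PowerSeries.C (2 / s) * rescale s tanhHalfSeries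

theorem constantCoeff_tangentSeries (s : ℂ) :
    PowerSeries.constantCoeff (tangentSeries s) = 0 := by
  rw [tangentSeries, map_mul, ← PowerSeries.coeff_zero_eq_constantCoeff_apply (rescale _ _),
    PowerSeries.coeff_rescale, PowerSeries.coeff_zero_eq_constantCoeff_apply,
    constantCoeff_tanhHalfSeries]
  simp

theorem derivative_tangentSeries {s : ℂ} (hs : s ≠ 0) :
    derivative ℂ (tangentSeries s) =
      1 - PowerSeries.C (s ^ 2 / 4) * tangentSeries s ^ 2 := by
  have h := congrArg (rescale s) two_mul_derivative_tanhHalfSeries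
  rw [map_mul, map_sub, map_pow, map_one, map_ofNat] at h
  have hC : PowerSeries.C (2 / s) * PowerSeries.C s = (2 : PowerSeries ℂ) := by
    rw [← map_mul, div_mul_cancel₀ _ hs, map_ofNat]
  have hC2 : PowerSeries.C (s ^ 2 / 4) * PowerSeries.C (2 / s) ^ 2 = (1 : PowerSeries ℂ) := by
    rw [← map_pow, ← map_mul, ← map_one PowerSeries.C]; congr 1; field_simp; norm_num
  rw [tangentSeries, Derivation.leibniz, PowerSeries.derivative_C, smul_zero, add_zero,
    smul_eq_mul, derivative_rescale]
  linear_combination rescale s (derivative ℂ tanhHalfSeries) * hC + h +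
    rescale s tanhHalfSeries ^ 2 * hC2

/-- The parameter enters only through `(s ^ 2) ^ n`, which is what makes the three counts
comparable. -/
theorem constantCoeff_iterate_derivative_tangentSeries {s : ℂ} (hs : s ≠ 0) (n : ℕ) :
    PowerSeries.constantCoeff ((derivative ℂ)^[2 * n + 1] (tangentSeries s)) =
      (s ^ 2) ^ n * 2 * (2 * (2 ^ (2 * n + 2) - 1) * (bernoulli (2 * n + 2) : ℂ) / (2 * n + 2)) := by
  rw [PowerSeries.constantCoeff_iterate_derivative, tangentSeries, PowerSeries.coeff_C_mul,
    PowerSeries.coeff_rescale, coeff_tanhHalfSeries, Nat.factorial_succ (2 * n + 1)]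
  have h1 : ((2 * n + 1).factorial : ℂ) ≠ 0 := by exact_mod_cast Nat.factorial_ne_zero _
  have h2 : (2 * n + 2 : ℂ) ≠ 0 := by exact_mod_cast Nat.succ_ne_zero (2 * n + 1)
  push_cast
  rw [show (2 * n + 1 + 1 : ℂ) = 2 * n + 2 by ring]
  field_simp
  ring

/-! ### Down-up permutations and alternating descents as weights -/

theorem altdes_eq_card {k : ℕ} (π : Equiv.Perm (Fin (k + 1))) :
    altdes π =
      (Finset.univ.filter fun i : Fin k => (π i.succ < π i.castSucc ↔ Even (i : ℕ))).card := by
  suffices altDescentSet π = (Finset.univ.filter fun i : Fin k =>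
      (π i.succ < π i.castSucc ↔ Even (i : ℕ))).map Fin.castSuccEmb by
    rw [altdes, this, Finset.card_map]
  ext i
  simp only [altDescentSet, Finset.mem_filter, Finset.mem_univ, true_and, Finset.mem_map,
    Fin.coe_castSuccEmb]
  induction i using Fin.lastCases with
  | last => simp [Fin.castSucc_ne_last]
  | cast i =>
    have hne : π i.succ ≠ π i.castSucc := fun h => i.castSucc_lt_succ.ne' (π.injective h)
    simp only [Fin.castSucc_inj, exists_eq_right]
    have h1 : (i.castSucc : ℕ) + 1 < k + 1 := by simp
    refine (exists_prop_of_true h1).trans ?_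
    change (Even (i : ℕ) ∧ π i.succ < π i.castSucc ∨ Odd (i : ℕ) ∧ π i.castSucc < π i.succ) ↔ _
    rw [← Nat.not_even_iff_odd]
    have := lt_or_gt_of_ne hne
    have := fun h : π i.succ < π i.castSucc => h.asymm
    tauto

theorem isDownUp_iff {k : ℕ} (π : Equiv.Perm (Fin (k + 1))) :
    IsDownUp π ↔ ∀ i : Fin k, (π i.succ < π i.castSucc ↔ Even (i : ℕ)) := by
  have key : ∀ i : Fin k, (π i.succ < π i.castSucc ↔ Even (i : ℕ)) ↔
      (Even (i : ℕ) → π i.succ < π i.castSucc) ∧ (Odd (i : ℕ) → π i.castSucc < π i.succ) := by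
    intro i
    have hne : π i.succ ≠ π i.castSucc := fun h => i.castSucc_lt_succ.ne' (π.injective h)
    rw [← Nat.not_even_iff_odd]
    have := lt_or_gt_of_ne hne
    have := fun h : π i.succ < π i.castSucc => h.asymm
    tauto
  simp only [key]
  constructor
  · intro h i
    exact h i.castSucc (by simp)
  · intro h i hi
    exact h ⟨i, by omega⟩

namespace WordWeight

/-- Forbidding double ascents and double descents leaves the alternating words; parity of the length
decides the last step. -/
theorem eval_alternating {R : Type*} [CommRing R] (u d : R) {m : ℕ} (f : Fin (m + 1) → ℕ)
    (s : Bool) :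
    (⟨u, d, 1, 0, 0⟩ : WordWeight R).eval s (f 0) (List.ofFn fun i : Fin m => f i.succ) =
      if ∀ i : Fin m, (f i.succ < f i.castSucc ↔ (s = true ↔ Even (i : ℕ))) then
        (if (s = true ↔ Even m) then u else d) else 0 := by
  induction m generalizing s with
  | zero => cases s <;> simp [eval]
  | succ m ih =>
    have i1 := ih (fun i => f i.succ) true
    have i2 := ih (fun i => f i.succ) false
    rw [List.ofFn_succ]
    simp only [eval, i1, i2, Fin.forall_fin_succ (n := m)]
    by_cases h : f 1 < f 0 <;> cases s <;>
      simp [h, Nat.even_add_one, -Nat.not_even_iff_odd]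

/-- Each ascent contributes `-1`, charged one step late: at the following step, or at the end of the
word. Hence the prefactor for a pending ascent. -/
theorem eval_ascentSign {R : Type*} [CommRing R] {m : ℕ} (f : Fin (m + 1) → ℕ) (s : Bool) :
    (⟨-1, 1, -1, -1, 1⟩ : WordWeight R).eval s (f 0) (List.ofFn fun i : Fin m => f i.succ) =
      (if s then -1 else 1) * ∏ i : Fin m, if f i.succ < f i.castSucc then 1 else -1 := by
  induction m generalizing s with
  | zero => cases s <;> simp [eval]
  | succ m ih =>
    have i1 := ih (fun i => f i.succ) true
    have i2 := ih (fun i => f i.succ) false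
    rw [List.ofFn_succ, Fin.prod_univ_succ]
    simp only [eval, i1, i2]
    by_cases h : f 1 < f 0 <;> cases s <;> simp [h]

theorem eval_wordOf {R : Type*} [CommRing R] (W : WordWeight R) {k : ℕ}
    (π : Equiv.Perm (Fin (k + 1))) :
    W.eval false 0 (wordOf π) = W.eval true (π 0) (List.ofFn fun i : Fin k => (π i.succ : ℕ)) := by
  simp [wordOf, List.ofFn_succ, eval]

open Classical in
theorem eval_alternating_wordOf {R : Type*} [CommRing R] (u d : R) {m : ℕ}
    (π : Equiv.Perm (Fin m)) :
    (⟨u, d, 1, 0, 0⟩ : WordWeight R).eval false 0 (wordOf π) =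
      if IsDownUp π then (if Even m then d else u) else 0 := by
  cases m with
  | zero =>
    have : IsDownUp π := fun i => i.elim0
    simp [wordOf, eval, this]
  | succ k =>
    rw [eval_wordOf, eval_alternating u d (fun i => (π i : ℕ)) true]
    simp only [isDownUp_iff, Nat.even_add_one, true_iff, Fin.val_fin_lt]
    split_ifs <;> rfl

end WordWeight

theorem neg_one_pow_altdes {R : Type*} [CommRing R] (n : ℕ) (π : Equiv.Perm (Fin (2 * n + 1))) :
    (-1 : R) ^ altdes π = (-1) ^ (n + 1) *
      (⟨-1, 1, -1, -1, 1⟩ : WordWeight R).eval false 0 (wordOf π) := by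
  rw [WordWeight.eval_wordOf, WordWeight.eval_ascentSign (fun i => (π i : ℕ)) true, if_pos rfl,
    altdes_eq_card, Finset.card_filter, ← Finset.prod_pow_eq_pow_sum]
  -- At place `i` the alternating sign is `(-1) ^ (i + 1)` times the ascent sign; the virtual
  -- initial ascent supplies one further `-1`.
  have hp : ∏ i : Fin (2 * n), (-1 : R) ^ ((i : ℕ) + 1) = (-1) ^ n := by
    rw [Fin.prod_univ_eq_prod_range (fun i => (-1 : R) ^ (i + 1)) (2 * n)]
    clear π
    induction n with
    | zero => simp
    | succ n ih =>
      rw [show 2 * (n + 1) = 2 * n + 1 + 1 by ring, Finset.prod_range_succ, Finset.prod_range_succ,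
        ih]
      simp [pow_add, pow_mul]
  rw [pow_succ, mul_assoc, ← mul_assoc (-1 : R) (-1), neg_one_mul, neg_neg, one_mul, ← hp,
    ← Finset.prod_mul_distrib]
  refine Finset.prod_congr rfl fun i _ => ?_
  simp only [Fin.val_fin_lt]
  by_cases h : Even (i : ℕ) <;> by_cases h' : π i.succ < π i.castSucc
  · simp [h, h', h.add_one.neg_one_pow]
  · simp [h, h', h.add_one.neg_one_pow]
  · simp [h, h', (Nat.not_even_iff_odd.1 h).add_one.neg_one_pow]
  · simp [h, h', (Nat.not_even_iff_odd.1 h).add_one.neg_one_pow]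

theorem isSimsun_iff {m : ℕ} (π : Equiv.Perm (Fin m)) :
    IsSimsun π ↔ WordWeight.IsSimsunWord (wordOf π) := by
  have h : ∀ k, HasDoubleDescent ((wordOf π).filter (· < k)) ↔
      HasDoubleDescent ((List.ofFn π).filter fun x : Fin m => (x : ℕ) < k) := fun k => by
    rw [← hasDoubleDescent_map_val, wordOf, ← Function.comp_def Fin.val π, ← List.map_ofFn,
      List.filter_map]
    rfl
  constructor
  · intro hs k
    rcases le_total k m with hk | hk
    · rw [h]; exact hs k hk
    · have := hs m le_rfl
      rw [← h] at this
      rw [List.filter_eq_self.2] at this ⊢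
      · exact this
      all_goals
        intro c hc
        have := WordWeight.lt_of_mem_words (WordWeight.mem_words.2 (wordOf_perm_range π)) c hc
        simp
        omega
  · intro hs k _
    rw [← h]
    exact hs k

open Classical in
theorem ncard_setOf_eq_sum {α R : Type*} [Fintype α] [CommRing R] (P : α → Prop) :
    (Set.ncard {x | P x} : R) = ∑ x, if P x then 1 else 0 := by
  rw [Set.ncard_eq_toFinset_card', Set.toFinset_ofPred, Finset.sum_boole]

/-! ### The three specialisations -/

open PowerSeries (derivative)

theorem derivative_tangentSeries_of_sq_eq {s c : ℂ} (hs : s ≠ 0) (hc : s ^ 2 = 4 * c) :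
    derivative ℂ (tangentSeries s) = 1 - PowerSeries.C c * tangentSeries s ^ 2 := by
  rw [derivative_tangentSeries hs, hc, mul_div_cancel_left₀ _ (by norm_num)]

theorem eulerNumber_odd_eq (n : ℕ) {s : ℂ} (hs : s ^ 2 = -4) :
    (eulerNumber (2 * n + 1) : ℂ) =
      PowerSeries.constantCoeff ((derivative ℂ)^[2 * n + 1] (tangentSeries s)) := by
  have hs0 : s ≠ 0 := by rintro rfl; norm_num at hs
  set y := tangentSeries s
  have hy : derivative ℂ y = 1 + y ^ 2 := by
    rw [derivative_tangentSeries_of_sq_eq (c := -1) hs0 (by rw [hs]; norm_num)]; simp [y]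
  -- At `0` these become `1, 0, 1, 0, 0`: alternating words ending in an ascent.
  have hW : (⟨1 + y ^ 2, y, 1 + y ^ 2, y, y⟩ : WordWeight (PowerSeries ℂ)).IsCompatible
      (derivative ℂ) := by
    constructor <;> simp [hy, pow_two] <;> ring
  have h := WordWeight.sum_words_eval hW hy (2 * n + 1)
  have h' := congrArg PowerSeries.constantCoeff h
  have hy0 : PowerSeries.constantCoeff y = 0 := constantCoeff_tangentSeries s
  classical
  rw [← h', ← sum_perm_eq_sum_words, map_sum, eulerNumber,
    ncard_setOf_eq_sum]
  refine Finset.sum_congr rfl fun π _ => ?_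
  rw [← WordWeight.eval_map, WordWeight.map]
  simp only [map_add, map_pow, map_one, hy0]
  have := WordWeight.eval_alternating_wordOf (1 : ℂ) 0 π
  simpa using this.symm

theorem ncard_isDownUp_isSimsun_eq (n : ℕ) {s : ℂ} (hs : s ^ 2 = -2) :
    (Set.ncard {π : Equiv.Perm (Fin (2 * n)) | IsDownUp π ∧ IsSimsun π} : ℂ) =
      PowerSeries.constantCoeff ((derivative ℂ)^[2 * n + 1] (tangentSeries s)) := by
  have hs0 : s ≠ 0 := by rintro rfl; norm_num at hs
  set v := tangentSeries s
  set u := derivative ℂ v with hu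
  have hv : u = 1 - PowerSeries.C (-1 / 2) * v ^ 2 :=
    derivative_tangentSeries_of_sq_eq hs0 (by rw [hs]; norm_num)
  have hC : PowerSeries.C (-1 / 2 : ℂ) * 2 = -1 := by
    rw [← map_ofNat PowerSeries.C, ← map_mul]; norm_num
  have hDu : derivative ℂ u = u * v := by
    have hC0 : derivative ℂ (PowerSeries.C (-1 / 2 : ℂ)) = 0 := by
      rw [PowerSeries.derivative_C]
    rw [hv, map_sub, Derivation.leibniz, hC0, Derivation.leibniz_pow, Derivation.map_one_eq_zero,
      ← hu, ← hv]
    simp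
    linear_combination (-u * v) * hC
  -- At `0` these become `0, 1, 1, 0, 0`: alternating words ending in a descent. Since `u` is
  -- already `v'`, length `2 * n` gives order `2 * n + 1`.
  have hW : (⟨u * v, u, u, v, 0⟩ : WordWeight (PowerSeries ℂ)).IsCompatible
      (derivative ℂ) := by
    constructor <;> simp [hDu, ← hu]
  have h' := congrArg PowerSeries.constantCoeff (WordWeight.sum_words_eval_simsun hW rfl (2 * n))
  have hv0 : PowerSeries.constantCoeff v = 0 := constantCoeff_tangentSeries s
  have hu0 : PowerSeries.constantCoeff u = 1 := by rw [hv]; simp [hv0]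
  classical
  rw [Function.iterate_succ_apply, ← hu, ← h', ← sum_perm_eq_sum_words,
    map_sum, ncard_setOf_eq_sum]
  refine Finset.sum_congr rfl fun π _ => ?_
  rw [apply_ite PowerSeries.constantCoeff, ← WordWeight.eval_map, WordWeight.map, ← isSimsun_iff]
  simp only [map_mul, map_zero, hv0, hu0]
  have := WordWeight.eval_alternating_wordOf (0 : ℂ) 1 π
  simp only [mul_zero, this]
  by_cases h1 : IsDownUp π <;> by_cases h2 : IsSimsun π <;> simp [h1, h2]

theorem eval_neg_one_altEulerianPoly_eq (n : ℕ) :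
    (((altEulerianPoly (2 * n + 1)).eval (-1) : ℤ) : ℂ) =
      (-1) ^ n * PowerSeries.constantCoeff ((derivative ℂ)^[2 * n + 1] (tangentSeries 2)) := by
  set y := tangentSeries 2
  have hy : derivative ℂ y = 1 - y ^ 2 := by
    rw [derivative_tangentSeries_of_sq_eq (c := 1) two_ne_zero (by norm_num)]; simp [y]
  -- At `0` these become the ascent signs `-1, 1, -1, -1, 1`.
  have hW : (⟨(1 - y) * (-1 - y), 1 - y, (1 - y) * (-1 - y), -1 - y, 1 - y⟩ :
      WordWeight (PowerSeries ℂ)).IsCompatible (derivative ℂ) := by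
    constructor <;> simp [hy] <;> ring
  have h := WordWeight.sum_words_eval hW (by simp [hy]; ring) (2 * n + 1)
  have hD : (derivative ℂ)^[2 * n + 1] (1 - y) = -(derivative ℂ)^[2 * n + 1] y := by
    rw [Function.iterate_succ_apply, Function.iterate_succ_apply, ← iterate_map_neg]
    congr 1
    simp
  have h' := congrArg PowerSeries.constantCoeff h
  simp only [hD] at h'
  have hy0 : PowerSeries.constantCoeff y = 0 := constantCoeff_tangentSeries 2
  rw [← neg_neg (PowerSeries.constantCoeff _), ← map_neg PowerSeries.constantCoeff, ← h',
    ← sum_perm_eq_sum_words, map_sum, altEulerianPoly, eval_finsetSum, Int.cast_sum, mul_neg,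
    ← neg_mul, Finset.mul_sum]
  refine Finset.sum_congr rfl fun π _ => ?_
  rw [← WordWeight.eval_map, WordWeight.map]
  simp only [map_sub, map_mul, map_neg, map_one, hy0]
  have := neg_one_pow_altdes (R := ℂ) n π
  simpa [pow_succ] using this

/-! ### Existence of the expansion -/

/-- The polynomials which are combinations of the `X ^ k * (1 + X) ^ (2 * n - 2 * k)`, `k ≤ n`. -/
noncomputable def gammaSpan (n : ℕ) : Submodule ℝ ℝ[X] :=
  Submodule.span ℝ ((fun k : ℕ => (X : ℝ[X]) ^ k * (1 + X) ^ (2 * n - 2 * k)) '' Set.Iic n)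

theorem X_mul_mem_gammaSpan {n : ℕ} {p : ℝ[X]} (hp : p ∈ gammaSpan n) :
    X * p ∈ gammaSpan (n + 1) := by
  induction hp using Submodule.span_induction with
  | mem p hp =>
    obtain ⟨k, hk, rfl⟩ := hp
    refine Submodule.subset_span ⟨k + 1, Nat.succ_le_succ hk, ?_⟩
    simp only [show 2 * (n + 1) - 2 * (k + 1) = 2 * n - 2 * k by omega]
    ring
  | zero => simp
  | add p q _ _ hp hq => rw [mul_add]; exact add_mem hp hq
  | smul c p _ hp => rw [mul_smul_comm]; exact Submodule.smul_mem _ _ hp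

theorem one_add_X_sq_mul_mem_gammaSpan {n : ℕ} {p : ℝ[X]} (hp : p ∈ gammaSpan n) :
    (1 + X) ^ 2 * p ∈ gammaSpan (n + 1) := by
  induction hp using Submodule.span_induction with
  | mem p hp =>
    obtain ⟨k, hk, rfl⟩ := hp
    have hk' : k ≤ n := hk
    refine Submodule.subset_span ⟨k, hk'.trans n.le_succ, ?_⟩
    simp only [show 2 * (n + 1) - 2 * k = 2 * n - 2 * k + 2 by omega]
    ring
  | zero => simp
  | add p q _ _ hp hq => rw [mul_add]; exact add_mem hp hq
  | smul c p _ hp => rw [mul_smul_comm]; exact Submodule.smul_mem _ _ hp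

theorem one_add_X_pow_mem_gammaSpan (n : ℕ) : (1 + X ^ (2 * n) : ℝ[X]) ∈ gammaSpan n := by
  induction n using Nat.twoStepInduction with
  | zero =>
    have : (1 : ℝ[X]) ∈ gammaSpan 0 := Submodule.subset_span ⟨0, Set.mem_Iic.2 le_rfl, by simp⟩
    simpa using add_mem this this
  | one =>
    have h0 : (1 : ℝ[X]) ∈ gammaSpan 0 := Submodule.subset_span ⟨0, Set.mem_Iic.2 le_rfl, by simp⟩
    have h1 := one_add_X_sq_mul_mem_gammaSpan h0
    have h2 := X_mul_mem_gammaSpan h0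
    convert sub_mem h1 (add_mem h2 h2) using 1
    ring
  | more n h0 h1 =>
    -- With `P n = 1 + X ^ (2 * n)`, the recursion is `P (n + 2) = (1 + X) ^ 2 * P (n + 1) - 2 * X *
    -- P (n + 1) - X ^ 2 * P n`.
    have a := one_add_X_sq_mul_mem_gammaSpan h1
    have b := X_mul_mem_gammaSpan h1
    have c := X_mul_mem_gammaSpan (X_mul_mem_gammaSpan h0)
    convert sub_mem (sub_mem a (add_mem b b)) c using 1
    ring

theorem X_pow_add_X_pow_mem_gammaSpan {n d e : ℕ} (h : d + e = 2 * n) :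
    (X ^ d + X ^ e : ℝ[X]) ∈ gammaSpan n := by
  wlog hde : d ≤ e generalizing d e
  · rw [add_comm]; exact this (by omega) (by omega)
  induction d generalizing n e with
  | zero =>
    obtain rfl : e = 2 * n := by omega
    simpa using one_add_X_pow_mem_gammaSpan n
  | succ d ih =>
    obtain ⟨n, rfl⟩ : ∃ m, n = m + 1 := ⟨n - 1, by omega⟩
    obtain ⟨e, rfl⟩ : ∃ m, e = m + 1 := ⟨e - 1, by omega⟩
    convert X_mul_mem_gammaSpan (ih (n := n) (e := e) (by omega) (by omega)) using 1
    ring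

theorem exists_gamma_of_mem_gammaSpan {n : ℕ} {p : ℝ[X]} (hp : p ∈ gammaSpan n) :
    ∃ a : ℕ → ℝ, p =
      ∑ k ∈ Finset.range (n + 1), C (a k) * (-2 * X) ^ k * (1 + X) ^ (2 * n - 2 * k) := by
  have e : ∀ (c : ℝ) (k : ℕ), (C (c / (-2) ^ k) * (-2 * X) ^ k : ℝ[X]) = C c * X ^ k := fun c k => by
    have : (-2 : ℝ[X]) = C (-2) := by rw [C_neg, C_ofNat]
    rw [mul_pow, this, ← C_pow, ← mul_assoc, ← C_mul,
      div_mul_cancel₀ _ (pow_ne_zero _ (by norm_num))]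
  induction hp using Submodule.span_induction with
  | mem p hp =>
    obtain ⟨k, hk, rfl⟩ := hp
    refine ⟨Pi.single k (1 / (-2) ^ k), ?_⟩
    rw [Finset.sum_eq_single k]
    · rw [Pi.single_eq_same, e]; simp
    · intro j _ hj
      simp [Pi.single_eq_of_ne hj]
    · intro h
      exact absurd (Finset.mem_range.2 (Nat.lt_succ_of_le hk)) h
  | zero => exact ⟨0, by simp⟩
  | add p q _ _ hp hq =>
    obtain ⟨a, rfl⟩ := hp
    obtain ⟨b, rfl⟩ := hq
    exact ⟨a + b, by simp [add_mul, Finset.sum_add_distrib]⟩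
  | smul c p _ hp =>
    obtain ⟨a, rfl⟩ := hp
    exact ⟨c • a, by simp [Finset.smul_sum, smul_eq_C_mul, mul_assoc]⟩

theorem altdes_add_altdes_rev {k : ℕ} (π : Equiv.Perm (Fin (k + 1))) :
    altdes π + altdes (Fin.revPerm * π) = k := by
  rw [altdes_eq_card, altdes_eq_card]
  have : ∀ i : Fin k, ((Fin.revPerm * π : Equiv.Perm _) i.succ <
      (Fin.revPerm * π : Equiv.Perm _) i.castSucc ↔ Even (i : ℕ)) ↔
      ¬ (π i.succ < π i.castSucc ↔ Even (i : ℕ)) := by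
    intro i
    have hne : π i.succ ≠ π i.castSucc := fun h => i.castSucc_lt_succ.ne' (π.injective h)
    simp only [Equiv.Perm.mul_apply, Fin.revPerm_apply, Fin.rev_lt_rev]
    have := lt_or_gt_of_ne hne
    have := fun h : π i.succ < π i.castSucc => h.asymm
    tauto
  simp only [this]
  rw [Finset.card_filter_add_card_filter_not, Finset.card_univ, Fintype.card_fin]

/-- Pairing each permutation with its complement writes twice the polynomial as a sum of terms `X ^
d + X ^ (2 * n - d)`. -/
theorem map_altEulerianPoly_mem_gammaSpan (n : ℕ) :
    (altEulerianPoly (2 * n + 1)).map (Int.castRingHom ℝ) ∈ gammaSpan n := by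
  have h1 : (altEulerianPoly (2 * n + 1)).map (Int.castRingHom ℝ) =
      ∑ π : Equiv.Perm (Fin (2 * n + 1)), X ^ altdes π := by
    simp [altEulerianPoly, Polynomial.map_sum]
  have h2 : (altEulerianPoly (2 * n + 1)).map (Int.castRingHom ℝ) =
      ∑ π : Equiv.Perm (Fin (2 * n + 1)), X ^ altdes (Fin.revPerm * π) := by
    rw [h1]
    exact (Equiv.sum_comp (Equiv.mulLeft Fin.revPerm) fun π => (X : ℝ[X]) ^ altdes π).symm
  have h3 : (2 : ℝ) • (altEulerianPoly (2 * n + 1)).map (Int.castRingHom ℝ) ∈ gammaSpan n := by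
    rw [two_smul]
    nth_rw 1 [h1]
    rw [h2, ← Finset.sum_add_distrib]
    exact Submodule.sum_mem _ fun π _ => X_pow_add_X_pow_mem_gammaSpan (altdes_add_altdes_rev π)
  simpa using Submodule.smul_mem _ (2⁻¹ : ℝ) h3

theorem exists_isAltGammaVector (n : ℕ) : ∃ a : ℕ → ℝ, IsAltGammaVector (2 * n + 1) a := by
  obtain ⟨a, ha⟩ := exists_gamma_of_mem_gammaSpan (map_altEulerianPoly_mem_gammaSpan n)
  refine ⟨a, ?_⟩
  rw [IsAltGammaVector, ha, Nat.add_sub_cancel, Nat.mul_div_cancel_left _ two_pos]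

theorem IsAltGammaVector.two_pow_mul_eq {n : ℕ} {a : ℕ → ℝ} (h : IsAltGammaVector (2 * n + 1) a) :
    2 ^ n * a n = (((altEulerianPoly (2 * n + 1)).eval (-1) : ℤ) : ℝ) := by
  rw [IsAltGammaVector, Nat.add_sub_cancel, Nat.mul_div_cancel_left _ two_pos] at h
  have h' := congrArg (Polynomial.eval (-1)) h
  rw [← Int.cast_one, ← Int.cast_neg, eval_intCast_map, eval_finsetSum, Finset.sum_range_succ,
    Finset.sum_eq_zero] at h'
  · simpa [mul_comm] using h'.symm
  · intro k hk
    have : 2 * n - 2 * k ≠ 0 := by have := Finset.mem_range.1 hk; omega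
    simp [this]

/-! ### Comparison of the values -/

theorem exists_sq_eq (c : ℂ) : ∃ s : ℂ, s ^ 2 = c := IsAlgClosed.exists_pow_nat_eq c two_pos

theorem eulerNumber_odd_eq_bernoulli (n : ℕ) : (eulerNumber (2 * n + 1) : ℂ) =
    (-4) ^ n * 2 * (2 * (2 ^ (2 * n + 2) - 1) * (bernoulli (2 * n + 2) : ℂ) / (2 * n + 2)) := by
  obtain ⟨s, hs⟩ := exists_sq_eq (-4)
  rw [eulerNumber_odd_eq n hs, constantCoeff_iterate_derivative_tangentSeries
    (by rintro rfl; norm_num at hs), hs]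

theorem eval_neg_one_altEulerianPoly_eq_eulerNumber (n : ℕ) :
    (altEulerianPoly (2 * n + 1)).eval (-1) = (eulerNumber (2 * n + 1) : ℤ) := by
  have h := eval_neg_one_altEulerianPoly_eq n
  rw [constantCoeff_iterate_derivative_tangentSeries two_ne_zero] at h
  have h' : (((altEulerianPoly (2 * n + 1)).eval (-1) : ℤ) : ℂ)
      = ((eulerNumber (2 * n + 1) : ℤ) : ℂ) := by
    rw [h, Int.cast_natCast, eulerNumber_odd_eq_bernoulli, ← mul_assoc, ← mul_assoc, ← mul_pow]
    norm_num
  exact_mod_cast h'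

theorem ncard_isDownUp_isSimsun_eq_div (n : ℕ) :
    (Set.ncard {π : Equiv.Perm (Fin (2 * n)) | IsDownUp π ∧ IsSimsun π} : ℚ) =
      (eulerNumber (2 * n + 1) : ℚ) / 2 ^ n := by
  obtain ⟨s, hs⟩ := exists_sq_eq (-2)
  rw [eq_div_iff (by positivity)]
  have h : (Set.ncard {π : Equiv.Perm (Fin (2 * n)) | IsDownUp π ∧ IsSimsun π} : ℂ) * 2 ^ n =
      (eulerNumber (2 * n + 1) : ℂ) := by
    rw [ncard_isDownUp_isSimsun_eq n hs, constantCoeff_iterate_derivative_tangentSeries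
      (by rintro rfl; norm_num at hs), hs, eulerNumber_odd_eq_bernoulli,
      show (-4 : ℂ) = -2 * 2 by norm_num, mul_pow]
    ring
  exact_mod_cast h

theorem eulerNumber_odd_div_eq_reducedTangentNumber (n : ℕ) :
    (eulerNumber (2 * n + 1) : ℚ) / 2 ^ n = reducedTangentNumber n := by
  have h : (eulerNumber (2 * n + 1) : ℚ) = (-4) ^ n * 2 *
      (2 * (2 ^ (2 * n + 2) - 1) * _root_.bernoulli (2 * n + 2) / (2 * n + 2)) := by
    exact_mod_cast eulerNumber_odd_eq_bernoulli n
  have h1 : (0 : ℚ) ≤ 2 ^ (2 * n + 2) - 1 := sub_nonneg.2 (one_le_pow₀ one_le_two)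
  have h2 : (0 : ℚ) ≤ 2 * n + 2 := by positivity
  have h' : (eulerNumber (2 * n + 1) : ℚ) = 4 ^ n * 2 *
      (2 * (2 ^ (2 * n + 2) - 1) * |_root_.bernoulli (2 * n + 2)| / (2 * n + 2)) := by
    -- A count equals its absolute value, so the sign of the Bernoulli number need not be known.
    rw [← Nat.abs_cast (eulerNumber _), h]
    simp only [abs_mul, abs_div, abs_pow, abs_neg, abs_of_nonneg h1, abs_of_nonneg h2,
      Nat.abs_ofNat]
  rw [h', reducedTangentNumber, show 2 * (n + 1) = 2 * n + 2 by ring,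
    show (4 : ℚ) = 2 * 2 by norm_num, mul_pow]
  push_cast
  field_simp
  ring

end AltDescent

theorem mainTheorem8 (n : ℕ) :
    (AltDescent.altEulerianPoly (2 * n + 1)).eval (-1)
        = (AltDescent.eulerNumber (2 * n + 1) : ℤ) ∧
    (∃ a : ℕ → ℝ, AltDescent.IsAltGammaVector (2 * n + 1) a) ∧
    (∀ a : ℕ → ℝ, AltDescent.IsAltGammaVector (2 * n + 1) a →
      2 ^ n * a n = (AltDescent.eulerNumber (2 * n + 1) : ℝ)) ∧
    (Set.ncard {π : Equiv.Perm (Fin (2 * n)) | AltDescent.IsDownUp π ∧ AltDescent.IsSimsun π} : ℚ)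
        = (AltDescent.eulerNumber (2 * n + 1) : ℚ) / 2 ^ n ∧
    (AltDescent.eulerNumber (2 * n + 1) : ℚ) / 2 ^ n = AltDescent.reducedTangentNumber n := by
  refine ⟨AltDescent.eval_neg_one_altEulerianPoly_eq_eulerNumber n,
    AltDescent.exists_isAltGammaVector n, fun a ha => ?_,
    AltDescent.ncard_isDownUp_isSimsun_eq_div n,
    AltDescent.eulerNumber_odd_div_eq_reducedTangentNumber n⟩
  rw [ha.two_pow_mul_eq, AltDescent.eval_neg_one_altEulerianPoly_eq_eulerNumber, Int.cast_natCast]
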